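/- **Generic configurations.** A generic configuration is a tuple $\xi=(L^\xi,\Delta_0^\xi,B^\xi,d,G)$ where 1. $L^\xi$ is a first-order language of arithmetic (numbered symbols, interpreted in the standard model $\mathbb N$) with $=$, $\le$, $0,1,2$, $\mathrm{Max}(x,y)$ and, for every $k\in\mathbb N$, a closed term $\bar k$ denoting $k$; 2. $\Delta_0^\xi$ is a set of formulas, all of whose quantifiers are bounded ($\forall v\le T$, $\exists v\le T$), that is closed under negation and contains formulas defining the graphs of addition and of multiplication in $\mathbb N$. A $\Pi_0^\xi$ or $\Sigma_0^\xi$ formula is a $\Delta_0^\xi$ formula; a $\Pi_{n+1}^\xi$ (resp. $\Sigma_{n+1}^\xi$) formula is a possibly empty block of unbounded universal (resp. existential) quantifiers followed by a $\Sigma_n^\xi$ (resp. $\Pi_n^\xi$) formula; 3. $B^\xi$ is a set of sentences true in $\mathbb N$ that proves, via $d$, every true $\Sigma_1^\xi$ sentence; 4. $d$ is a deduction method: a relation "$P$ is a proof of $Z$ from $\alpha$" that is sound for first-order logic and such that $Z$ is provable from $\alpha$ whenever $X$, $Y$ and $(X\wedge Y)\rightarrow Z$ are; 5. $G$ assigns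 Gödel numbers injectively to proofs and to formulas. A proof is identified with its Gödel number $p$, and $\mathrm{Log}$ is the logarithm to base 2 (with $\mathrm{Log}(0)=0$). **Stability.** A $\Pi_1^\xi$ or $\Sigma_1^\xi$ sentence is $\mathrm{Good}(N)$ if it is true in $\mathbb N$ when its unbounded quantifiers range over $v<2^N$ only. For a set $\theta$ of $\Pi_1^\xi$ sentences, $\sharp(\theta)$ is the largest integer $J\ge 0$ such that every sentence of $\theta$ is $\mathrm{Good}(J)$ ($\infty$ if all $J$ qualify, $-\infty$ if none does). Then $\xi$ is * *A-stable* if for every r.e. set $\theta$ of $\Pi_1^\xi$ sentences (true or not), every $\Pi_1^\xi$ sentence that has a proof $p$ from $\theta\cup B^\xi$ with $\mathrm{Log}(p)\le\sharp(\theta)+1$ is $\mathrm{Good}(\tfrac12\sharp(\theta))$; * *E-stable* if for every such $\theta$, every $\Sigma_1^\xi$ sentence that has a proof $p$ from $\theta\cup B^\xi$ with $\mathrm{Log}(p)\le\sharp(\theta)+1$ is $\mathrm{Good}(\tfrac12\lfloor\mathrm{Log}(p)\rfloor-1)$; * *EA-stable* if it is both E-stable and A-stable; * *0-stable* if for every such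 $\theta$, every $\Delta_0^\xi$ sentence that has a proof $p$ from $\theta\cup B^\xi$ with $\mathrm{Log}(p)\le\sharp(\theta)+1$ is true in $\mathbb N$. **The self-consistency sentence.** $\mathrm{Neg}^k(x,y)$ says that $x$ is the Gödel number of a $\Pi_k^\xi$ sentence and $y$ that of the $\Sigma_k^\xi$ sentence which is its formal negation (prefix quantifiers flipped, matrix negated). $\mathrm{SubstPrf}_\beta(g,t,p)$ says, for $g$ the Gödel number of a formula $\gamma$ with one free variable, that $p$ is the Gödel number of a proof, via $d$, of the sentence with Gödel number $t$ from the axioms $\beta\cup\{\gamma(\bar g)\}$. $\mathrm{SelfCons}^k(\beta,d)$ denotes any $\Pi_1^\xi$ sentence $\Gamma(\bar n)$, where $n$ is the Gödel number of $$\Gamma(g)\;=\;\forall x\,\forall y\,\forall p\,\forall q\,\forall\vec u\,\forall\vec w\;\;\neg\{\nu(x,y)\wedge\sigma(g,x,p,\vec u)\wedge\sigma(g,y,q,\vec w)\},$$ $\nu$ is a $\Delta_0^\xi$ formula that defines $\mathrm{Neg}^k$ in $\mathbb N$, and $\sigma$ is a $\Delta_0^\xi$ formula such that $\exists\vec w\,\sigma(g,t,p,\vec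 w)$ defines $\mathrm{SubstPrf}_\beta$ in $\mathbb N$; the tuples $\vec u,\vec w$ have the same length and may be empty. Thus it states that no $\Pi_k^\xi$ sentence is provable together with its negation from $\beta$ and this very sentence. **Theorem.** Let $\xi$ be a generic configuration and let $G_k^\xi(\theta)=\theta\cup B^\xi\cup\{\mathrm{SelfCons}^k(\theta\cup B^\xi,d)\}$. Call $G_k^\xi$ *consistency preserving* if, for every r.e. set $\theta$ of $\Pi_1^\xi$ sentences that are all true in $\mathbb N$, the system $G_k^\xi(\theta)$ is consistent: there is no sentence such that both it and its negation are provable from $G_k^\xi(\theta)$ via $d$. Then * if $\xi$ is EA-stable, $G_1^\xi$ is consistency preserving; * if $\xi$ is A-stable, E-stable or 0-stable, $G_0^\xi$ is consistency preserving. -/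

import Mathlib

open FirstOrder

namespace SelfJust

/-! ## Syntax and semantics -/

/-- First-order formulas over `L` whose free variables are among `0, …, n - 1`. The bounded
quantifiers `∀ v ≤ t` and `∃ v ≤ t` are primitive, so that a quantifier is syntactically either
bounded or unbounded. A quantifier over a formula in `n + 1` variables binds the last one. -/
inductive Fml (L : FirstOrder.Language.{0, 0}) [L.IsOrdered] : ℕ → Type
  | eq {n : ℕ} (s t : L.Term (Fin n)) : Fml L n
  | rel {n k : ℕ} (R : L.Relations k) (ts : Fin k → L.Term (Fin n)) : Fml L n
  | neg {n : ℕ} (φ : Fml L n) : Fml L n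
  | and {n : ℕ} (φ ψ : Fml L n) : Fml L n
  | or {n : ℕ} (φ ψ : Fml L n) : Fml L n
  | imp {n : ℕ} (φ ψ : Fml L n) : Fml L n
  | ball {n : ℕ} (t : L.Term (Fin n)) (φ : Fml L (n + 1)) : Fml L n
  | bex {n : ℕ} (t : L.Term (Fin n)) (φ : Fml L (n + 1)) : Fml L n
  | all {n : ℕ} (φ : Fml L (n + 1)) : Fml L n
  | ex {n : ℕ} (φ : Fml L (n + 1)) : Fml L n

/-- Sentences. -/
abbrev Sent (L : FirstOrder.Language.{0, 0}) [L.IsOrdered] : Type := Fml L 0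

namespace Fml

variable {L : FirstOrder.Language.{0, 0}} [L.IsOrdered]

/-- Truth of a formula in the structure `M`, where the *unbounded* quantifiers range over `U` only
(the bounded quantifiers are not affected). Ordinary truth is the case `U = Set.univ`. -/
def RealizeIn (M : Type) [L.Structure M] (U : Set M) : {n : ℕ} → Fml L n → (Fin n → M) → Prop
  | _, eq s t, v => s.realize v = t.realize v
  | _, rel R ts, v => FirstOrder.Language.Structure.RelMap R fun i => (ts i).realize v
  | _, neg φ, v => ¬ RealizeIn M U φ v
  | _, and φ ψ, v => RealizeIn M U φ v ∧ RealizeIn M U ψ v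
  | _, or φ ψ, v => RealizeIn M U φ v ∨ RealizeIn M U ψ v
  | _, imp φ ψ, v => RealizeIn M U φ v → RealizeIn M U ψ v
  | _, ball t φ, v => ∀ a : M,
      FirstOrder.Language.Structure.RelMap (FirstOrder.Language.leSymb : L.Relations 2) ![a, t.realize v] →
        RealizeIn M U φ (Fin.snoc v a)
  | _, bex t φ, v => ∃ a : M,
      FirstOrder.Language.Structure.RelMap (FirstOrder.Language.leSymb : L.Relations 2) ![a, t.realize v] ∧
        RealizeIn M U φ (Fin.snoc v a)
  | _, all φ, v => ∀ a ∈ U, RealizeIn M U φ (Fin.snoc v a)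
  | _, ex φ, v => ∃ a ∈ U, RealizeIn M U φ (Fin.snoc v a)

/-- Ordinary truth of a formula in a structure, under an assignment. -/
def Realize (M : Type) [L.Structure M] {n : ℕ} (φ : Fml L n) (v : Fin n → M) : Prop :=
  φ.RealizeIn M Set.univ v

/-- Simultaneous substitution of terms for the free variables. -/
def subst : {n m : ℕ} → Fml L n → (Fin n → L.Term (Fin m)) → Fml L m
  | _, _, eq s t, σ => eq (s.subst σ) (t.subst σ)
  | _, _, rel R ts, σ => rel R fun i => (ts i).subst σ
  | _, _, neg φ, σ => neg (φ.subst σ)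
  | _, _, and φ ψ, σ => and (φ.subst σ) (ψ.subst σ)
  | _, _, or φ ψ, σ => or (φ.subst σ) (ψ.subst σ)
  | _, _, imp φ ψ, σ => imp (φ.subst σ) (ψ.subst σ)
  | _, m, ball t φ, σ => ball (t.subst σ)
      (φ.subst (Fin.snoc (fun i => (σ i).relabel Fin.castSucc) (FirstOrder.Language.var (Fin.last m))))
  | _, m, bex t φ, σ => bex (t.subst σ)
      (φ.subst (Fin.snoc (fun i => (σ i).relabel Fin.castSucc) (FirstOrder.Language.var (Fin.last m))))
  | _, m, all φ, σ => all
      (φ.subst (Fin.snoc (fun i => (σ i).relabel Fin.castSucc) (FirstOrder.Language.var (Fin.last m))))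
  | _, m, ex φ, σ => ex
      (φ.subst (Fin.snoc (fun i => (σ i).relabel Fin.castSucc) (FirstOrder.Language.var (Fin.last m))))

/-- All quantifiers of the formula are bounded. -/
def FullyBounded : {n : ℕ} → Fml L n → Prop
  | _, eq _ _ => True
  | _, rel _ _ => True
  | _, neg φ => φ.FullyBounded
  | _, and φ ψ => φ.FullyBounded ∧ ψ.FullyBounded
  | _, or φ ψ => φ.FullyBounded ∧ ψ.FullyBounded
  | _, imp φ ψ => φ.FullyBounded ∧ ψ.FullyBounded
  | _, ball _ φ => φ.FullyBounded
  | _, bex _ φ => φ.FullyBounded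
  | _, all _ => False
  | _, ex _ => False

/-- The universal closure `∀ v₁ … ∀ vₖ φ` of the last `k` variables. -/
def alls {n : ℕ} : (k : ℕ) → Fml L (n + k) → Fml L n
  | 0, φ => φ
  | k + 1, φ => alls k (all φ)

/-- The formal negation of a prenex formula: the unbounded quantifiers of the prefix are flipped
and the matrix is negated. -/
def prenexNeg : {n : ℕ} → Fml L n → Fml L n
  | _, all φ => ex φ.prenexNeg
  | _, ex φ => all φ.prenexNeg
  | _, φ => neg φ

/-- The standard numbering of formulas, computed by recursion from a numbering of the symbols. It
is used only to say which sets of sentences are recursively enumerable. -/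
def code [Encodable (Σ l, L.Functions l)] [Encodable (Σ l, L.Relations l)] :
    {n : ℕ} → Fml L n → ℕ
  | _, eq s t => Nat.pair 0 (Nat.pair (Encodable.encode s) (Encodable.encode t))
  | _, rel (k := k) R ts => Nat.pair 1 (Nat.pair
      (Encodable.encode (⟨k, R⟩ : Σ l, L.Relations l))
      (Encodable.encode (List.ofFn fun i => Encodable.encode (ts i))))
  | _, neg φ => Nat.pair 2 φ.code
  | _, and φ ψ => Nat.pair 3 (Nat.pair φ.code ψ.code)
  | _, or φ ψ => Nat.pair 4 (Nat.pair φ.code ψ.code)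
  | _, imp φ ψ => Nat.pair 5 (Nat.pair φ.code ψ.code)
  | _, ball t φ => Nat.pair 6 (Nat.pair (Encodable.encode t) φ.code)
  | _, bex t φ => Nat.pair 7 (Nat.pair (Encodable.encode t) φ.code)
  | _, all φ => Nat.pair 8 φ.code
  | _, ex φ => Nat.pair 9 φ.code

end Fml

mutual

/-- `Π_k` formulas over a class `D` of `Δ₀` formulas: `Π₀` is `D`, and a `Π_{k+1}` formula is a
(possibly empty) block of universal quantifiers in front of a `Σ_k` formula. -/
inductive IsPi {L : FirstOrder.Language.{0, 0}} [L.IsOrdered] (D : (n : ℕ) → Set (Fml L n)) :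
    ℕ → (n : ℕ) → Fml L n → Prop
  | delta {n : ℕ} {φ : Fml L n} : φ ∈ D n → IsPi D 0 n φ
  | matrix {k n : ℕ} {φ : Fml L n} : IsSigma D k n φ → IsPi D (k + 1) n φ
  | all {k n : ℕ} {φ : Fml L (n + 1)} : IsPi D (k + 1) (n + 1) φ → IsPi D (k + 1) n (Fml.all φ)

/-- `Σ_k` formulas over a class `D` of `Δ₀` formulas. -/
inductive IsSigma {L : FirstOrder.Language.{0, 0}} [L.IsOrdered] (D : (n : ℕ) → Set (Fml L n)) :
    ℕ → (n : ℕ) → Fml L n → Prop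
  | delta {n : ℕ} {φ : Fml L n} : φ ∈ D n → IsSigma D 0 n φ
  | matrix {k n : ℕ} {φ : Fml L n} : IsPi D k n φ → IsSigma D (k + 1) n φ
  | ex {k n : ℕ} {φ : Fml L (n + 1)} :
      IsSigma D (k + 1) (n + 1) φ → IsSigma D (k + 1) n (Fml.ex φ)

end

/-! ## Generic configurations -/

/-- A language for arithmetic with (logical symbols and) symbols for `0`, `1`, `2`, `≤` and the
maximum, numbered symbols, its standard model with universe `ℕ`, and for every `k` a closed term
denoting `k`. -/
structure ArithLanguage where
  L : FirstOrder.Language.{0, 0}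
  [ord : L.IsOrdered]
  [encFunctions : Encodable (Σ l, L.Functions l)]
  [encRelations : Encodable (Σ l, L.Relations l)]
  [std : L.Structure ℕ]
  zero : L.Functions 0
  one : L.Functions 0
  two : L.Functions 0
  maximum : L.Functions 2
  numeral : ℕ → L.Term (Fin 0)
  std_le : ∀ a b : ℕ, FirstOrder.Language.Structure.RelMap (FirstOrder.Language.leSymb : L.Relations 2) ![a, b] ↔ a ≤ b
  std_zero : FirstOrder.Language.Structure.funMap zero (![] : Fin 0 → ℕ) = 0
  std_one : FirstOrder.Language.Structure.funMap one (![] : Fin 0 → ℕ) = 1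
  std_two : FirstOrder.Language.Structure.funMap two (![] : Fin 0 → ℕ) = 2
  std_maximum : ∀ a b : ℕ, FirstOrder.Language.Structure.funMap maximum ![a, b] = max a b
  std_numeral : ∀ k : ℕ, (numeral k).realize (![] : Fin 0 → ℕ) = k

attribute [instance] ArithLanguage.ord ArithLanguage.encFunctions ArithLanguage.encRelations
  ArithLanguage.std

/-- A deduction method: a relation "`P` is a proof of `φ` from the axioms `α`" that is sound for
first-order logic and satisfies the indirect-implication property (which does not presuppose a
modus ponens rule). -/
structure DeductionMethod (L : FirstOrder.Language.{0, 0}) [L.IsOrdered] where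
  Proof : Type
  IsProof : Proof → Set (Sent L) → Sent L → Prop
  sound : ∀ (P : Proof) (α : Set (Sent L)) (φ : Sent L), IsProof P α φ →
    ∀ (M : Type) [L.Structure M] [Nonempty M],
      (∀ ψ ∈ α, ψ.Realize M ![]) → φ.Realize M ![]
  indirect_implication : ∀ (α : Set (Sent L)) (X Y Z : Sent L),
    (∃ P, IsProof P α X) → (∃ P, IsProof P α Y) → (∃ P, IsProof P α (.imp (.and X Y) Z)) →
      ∃ P, IsProof P α Z

/-- A generic configuration `(L, Δ₀, B, d, G)`. -/
structure GenericConfiguration where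
  lang : ArithLanguage
  /-- The class `Δ₀`, by number of free variables. -/
  delta : (n : ℕ) → Set (Fml lang.L n)
  delta_fullyBounded : ∀ (n : ℕ), ∀ φ ∈ delta n, φ.FullyBounded
  delta_neg : ∀ (n : ℕ), ∀ φ ∈ delta n, φ.neg ∈ delta n
  delta_add : ∃ φ ∈ delta 3, ∀ x y z : ℕ, φ.Realize ℕ ![x, y, z] ↔ x + y = z
  delta_mult : ∃ φ ∈ delta 3, ∀ x y z : ℕ, φ.Realize ℕ ![x, y, z] ↔ x * y = z
  /-- The deduction method `d`. -/
  ded : DeductionMethod lang.L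
  /-- The base axiom system `B`. -/
  base : Set (Sent lang.L)
  base_true : ∀ φ ∈ base, φ.Realize ℕ ![]
  base_sigma_complete : ∀ φ : Sent lang.L, IsSigma delta 1 0 φ → φ.Realize ℕ ![] →
    ∃ P, ded.IsProof P base φ
  /-- The encoding `G`: Gödel numbers of formulas and of proofs. -/
  num : {n : ℕ} → Fml lang.L n → ℕ
  num_injective : ∀ n : ℕ, Function.Injective (num : Fml lang.L n → ℕ)
  proofNum : ded.Proof → ℕ
  proofNum_injective : Function.Injective proofNum

/-- `2 ^ N` for an extended real exponent. -/
noncomputable def twoPow : EReal → ENNReal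
  | ⊥ => 0
  | ⊤ => ⊤
  | (N : ℝ) => ENNReal.ofReal ((2 : ℝ) ^ N)

namespace GenericConfiguration

variable (ξ : GenericConfiguration)

/-- Truth of a sentence in the standard model. -/
def IsTrue (φ : Sent ξ.lang.L) : Prop := φ.Realize ℕ ![]

/-- `p` is the Gödel number of a proof of `φ` from `α`. -/
def PrfNum (α : Set (Sent ξ.lang.L)) (φ : Sent ξ.lang.L) (p : ℕ) : Prop :=
  ∃ P : ξ.ded.Proof, ξ.proofNum P = p ∧ ξ.ded.IsProof P α φ

/-- `φ` is a theorem of `α`. -/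
def Provable (α : Set (Sent ξ.lang.L)) (φ : Sent ξ.lang.L) : Prop :=
  ∃ P : ξ.ded.Proof, ξ.ded.IsProof P α φ

/-- No sentence is provable together with its negation. -/
def Consistent (α : Set (Sent ξ.lang.L)) : Prop :=
  ¬ ∃ φ : Sent ξ.lang.L, ξ.Provable α φ ∧ ξ.Provable α φ.neg

/-! ### Goodness and stability -/

/-- The prenex sentence `φ` is `Good(N)`: it is true in the standard model when its unbounded
quantifiers `∀ v`, `∃ v` are replaced by `∀ v < 2 ^ N`, `∃ v < 2 ^ N`. -/
def Good (N : EReal) (φ : Sent ξ.lang.L) : Prop :=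
  φ.RealizeIn ℕ {v : ℕ | (v : ENNReal) < twoPow N} ![]

/-- `♯(θ)`: the largest `J` such that all sentences of `θ` are `Good(J)`. It is `⊤` if there is no
largest one, and `⊥` if there is none at all. -/
noncomputable def sharp (θ : Set (Sent ξ.lang.L)) : EReal :=
  sSup {N : EReal | ∃ J : ℕ, N = ((J : ℝ) : EReal) ∧ ∀ φ ∈ θ, ξ.Good N φ}

/-- R-views: recursively enumerable sets of `Π₁` sentences (true or not). -/
def IsRView (θ : Set (Sent ξ.lang.L)) : Prop :=
  (∀ φ ∈ θ, IsPi ξ.delta 1 0 φ) ∧ REPred fun c : ℕ => ∃ φ ∈ θ, φ.code = c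

def AStable : Prop :=
  ∀ θ, ξ.IsRView θ → ∀ (φ : Sent ξ.lang.L) (p : ℕ), IsPi ξ.delta 1 0 φ →
    ξ.PrfNum (θ ∪ ξ.base) φ p → ((Real.logb 2 p : ℝ) : EReal) ≤ ξ.sharp θ + 1 →
      ξ.Good (((1 / 2 : ℝ) : EReal) * ξ.sharp θ) φ

def EStable : Prop :=
  ∀ θ, ξ.IsRView θ → ∀ (φ : Sent ξ.lang.L) (p : ℕ), IsSigma ξ.delta 1 0 φ →
    ξ.PrfNum (θ ∪ ξ.base) φ p → ((Real.logb 2 p : ℝ) : EReal) ≤ ξ.sharp θ + 1 →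
      ξ.Good ((1 / 2 * (⌊Real.logb 2 p⌋ : ℝ) - 1 : ℝ) : EReal) φ

def EAStable : Prop := ξ.EStable ∧ ξ.AStable

def ZeroStable : Prop :=
  ∀ θ, ξ.IsRView θ → ∀ (φ : Sent ξ.lang.L) (p : ℕ), φ ∈ ξ.delta 0 →
    ξ.PrfNum (θ ∪ ξ.base) φ p → ((Real.logb 2 p : ℝ) : EReal) ≤ ξ.sharp θ + 1 → ξ.IsTrue φ

/-! ### The self-consistency sentence -/

/-- `Neg^k(x, y)`: `x` is the Gödel number of a `Π_k` sentence and `y` is that of the `Σ_k`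
sentence which is its formal negation. -/
def NegRel (k : ℕ) (x y : ℕ) : Prop :=
  ∃ φ : Sent ξ.lang.L, IsPi ξ.delta k 0 φ ∧ ξ.num φ = x ∧ ξ.num φ.prenexNeg = y

/-- The sentence `γ(ḡ)`, where the free variable of `γ` is replaced by the numeral of the Gödel
number `g` of `γ` itself. -/
def diag (γ : Fml ξ.lang.L 1) : Sent ξ.lang.L :=
  γ.subst fun _ => ξ.lang.numeral (ξ.num γ)

/-- The formula `ν` in `x, y` expresses the relation `Neg^k(x, y)`. -/
def ExpressesNeg (k : ℕ) (ν : Fml ξ.lang.L 2) : Prop :=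
  ∀ x y : ℕ, ν.Realize ℕ ![x, y] ↔ ξ.NegRel k x y

/-- The formula `∃ w₁ … ∃ wₘ σ(g, t, p, w)` expresses the relation `SubstPrf_β(g, t, p)`: if `g` is
the Gödel number of a formula `γ`, then `p` is the Gödel number of a proof of the sentence with
Gödel number `t` from `β` together with the sentence `γ(ḡ)`. -/
def ExpressesSubstPrf (β : Set (Sent ξ.lang.L)) (m : ℕ) (σ : Fml ξ.lang.L (3 + m)) : Prop :=
  ∀ (γ : Fml ξ.lang.L 1) (t p : ℕ),
    (∃ w : Fin m → ℕ, σ.Realize ℕ (Fin.append ![ξ.num γ, t, p] w)) ↔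
      ∃ φ : Sent ξ.lang.L, ξ.num φ = t ∧ ξ.PrfNum (β ∪ {ξ.diag γ}) φ p

/-- The formula `Γ(g)`, i.e. `∀ x ∀ y ∀ p ∀ q ∀ u₁ … ∀ uₘ ∀ w₁ … ∀ wₘ
¬ (ν(x, y) ∧ σ(g, x, p, u) ∧ σ(g, y, q, w))`. Its variables are, in this order,
`g, x, y, p, q, u, w`. -/
def gammaFml (ν : Fml ξ.lang.L 2) (m : ℕ) (σ : Fml ξ.lang.L (3 + m)) : Fml ξ.lang.L 1 :=
  let X (i : ℕ) (h : i < 5 + (m + m)) : ξ.lang.L.Term (Fin (1 + (4 + (m + m)))) :=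
    FirstOrder.Language.var ⟨i, by omega⟩
  Fml.alls (4 + (m + m)) <| .neg <|
    .and (ν.subst ![X 1 (by omega), X 2 (by omega)]) <|
      .and
        (σ.subst (Fin.append ![X 0 (by omega), X 1 (by omega), X 3 (by omega)]
          fun i : Fin m => X (5 + i) (by omega)))
        (σ.subst (Fin.append ![X 0 (by omega), X 2 (by omega), X 4 (by omega)]
          fun i : Fin m => X (5 + m + i) (by omega)))

/-- `Φ` is an encoding of the sentence `SelfCons^k(β, d)`: it is the `Π₁` sentence `Γ(n̄)`, where
`n` is the Gödel number of `Γ(g)` and where the formulas `ν` and `σ` used in `Γ` are `Δ₀` and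
express `Neg^k` and `SubstPrf_β`. The case `m = 0` is the one where `SubstPrf_β` itself is `Δ₀`;
for `m > 0` the variables `w` can hold certificates for the membership of axioms in `β`. -/
def IsSelfCons (k : ℕ) (β : Set (Sent ξ.lang.L)) (Φ : Sent ξ.lang.L) : Prop :=
  ∃ ν ∈ ξ.delta 2, ∃ m : ℕ, ∃ σ ∈ ξ.delta (3 + m),
    ξ.ExpressesNeg k ν ∧ ξ.ExpressesSubstPrf β m σ ∧
      Φ = ξ.diag (ξ.gammaFml ν m σ) ∧ IsPi ξ.delta 1 0 Φ

/-- The map `θ ↦ G_k(θ) = θ ∪ B ∪ SelfCons^k(θ ∪ B, d)` is consistency preserving: `G_k(θ)` is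
consistent whenever `θ` is an r.e. set of `Π₁` sentences that are true in the standard model. -/
def ConsistencyPreserving (k : ℕ) : Prop :=
  ∀ θ, ξ.IsRView θ → (∀ φ ∈ θ, ξ.IsTrue φ) →
    ∀ Φ, ξ.IsSelfCons k (θ ∪ ξ.base) Φ → ξ.Consistent (θ ∪ ξ.base ∪ {Φ})

end GenericConfiguration

end SelfJust

open FirstOrder

namespace SelfJust

-- Semantics of substitution, closure and formal negation

namespace Fml

variable {L : FirstOrder.Language.{0, 0}} [L.IsOrdered]

-- If `G_k(θ)` is inconsistent, soundness forces its only possibly false axiom, the self-consistency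
-- sentence `Φ`, to be false. Take the least `N` for which `Φ` is not `Good(N)`. The failure
-- supplies a `Π_k` sentence `φ` and proofs `p`, `q` of `φ` and of its formal negation from `θ ∪ B ∪
-- {Φ}`, all with Gödel numbers below `2 ^ N`. Since `φ` and its negation have different numbers, `N
-- = J + 1`, and minimality makes `Φ` `Good(J)`. So `θ' = θ ∪ {Φ}`, although it contains a false
-- sentence, has `♯(θ') ≥ J`, while `Log p` and `Log q` are below `J + 1`: both proofs are short
-- enough for the stability hypotheses. This is `exists_short_proofs_of_not_consistent`.
--
-- For `k = 1`, A-stability makes `φ` good at `½♯(θ')` and E-stability makes its negation good at a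
-- level that is no higher. Goodness of `Π₁` sentences passes to lower levels, so both hold at the
-- same level, which is absurd. For `k = 0`, goodness of a `Δ₀` sentence is just truth, and A- and
-- E-stability each imply 0-stability.

theorem realizeIn_subst (M : Type) [L.Structure M] (U : Set M) {n m : ℕ} (φ : Fml L n)
    (σ : Fin n → L.Term (Fin m)) (v : Fin m → M) :
    (φ.subst σ).RealizeIn M U v ↔ φ.RealizeIn M U fun i => (σ i).realize v := by
  -- Evaluating the substitution lifted under a binder extends the evaluated assignment by the bound
  -- value.
  have key : ∀ {n m : ℕ} (σ : Fin n → L.Term (Fin m)) (v : Fin m → M) (a : M),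
      (fun i => ((Fin.snoc (fun i => (σ i).relabel Fin.castSucc)
        (FirstOrder.Language.var (Fin.last m)) : Fin (n + 1) → L.Term (Fin (m + 1))) i).realize
          (Fin.snoc v a : Fin (m + 1) → M)) =
        (Fin.snoc (fun i => (σ i).realize v) a : Fin (n + 1) → M) := by
    intro n m σ v a
    funext i
    refine Fin.lastCases ?_ (fun i => ?_) i
    · simp
    · simp only [Fin.snoc_castSucc, FirstOrder.Language.Term.realize_relabel]
      congr 1
      funext j
      simp
  induction φ generalizing m with
  | eq s t => simp [subst, RealizeIn]
  | rel R ts => simp [subst, RealizeIn]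
  | neg φ ih => simp only [subst, RealizeIn, ih]
  | and φ ψ ih₁ ih₂ => simp only [subst, RealizeIn, ih₁, ih₂]
  | or φ ψ ih₁ ih₂ => simp only [subst, RealizeIn, ih₁, ih₂]
  | imp φ ψ ih₁ ih₂ => simp only [subst, RealizeIn, ih₁, ih₂]
  | ball t φ ih =>
    simp only [subst, RealizeIn, ih, key, FirstOrder.Language.Term.realize_subst]
  | bex t φ ih =>
    simp only [subst, RealizeIn, ih, key, FirstOrder.Language.Term.realize_subst]
  | all φ ih => simp only [subst, RealizeIn, ih, key]
  | ex φ ih => simp only [subst, RealizeIn, ih, key]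

theorem FullyBounded.realizeIn_iff {M : Type} [L.Structure M] (U : Set M) {n : ℕ} {φ : Fml L n}
    (h : φ.FullyBounded) (v : Fin n → M) : φ.RealizeIn M U v ↔ φ.Realize M v := by
  unfold Realize
  induction φ with
  | eq s t => rfl
  | rel R ts => rfl
  | neg φ ih => simp only [RealizeIn, ih h]
  | and φ ψ ih₁ ih₂ => simp only [RealizeIn, ih₁ h.1, ih₂ h.2]
  | or φ ψ ih₁ ih₂ => simp only [RealizeIn, ih₁ h.1, ih₂ h.2]
  | imp φ ψ ih₁ ih₂ => simp only [RealizeIn, ih₁ h.1, ih₂ h.2]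
  | ball t φ ih => simp only [RealizeIn, ih h]
  | bex t φ ih => simp only [RealizeIn, ih h]
  | all φ ih => exact h.elim
  | ex φ ih => exact h.elim

theorem realizeIn_alls (M : Type) [L.Structure M] (U : Set M) {n : ℕ} (k : ℕ)
    (φ : Fml L (n + k)) (v : Fin n → M) :
    (alls k φ).RealizeIn M U v ↔
      ∀ w : Fin k → M, (∀ i, w i ∈ U) → φ.RealizeIn M U (Fin.append v w) := by
  induction k with
  | zero =>
    have h (w : Fin 0 → M) : Fin.append v w = v := by
      funext i
      exact Fin.append_left v w i
    simp [alls, h]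
  | succ k ih =>
    have h (w : Fin k → M) (a : M) :
        Fin.append v (Fin.snoc w a : Fin (k + 1) → M) = Fin.snoc (Fin.append v w) a :=
      Fin.append_snoc v w a
    rw [alls, ih]
    constructor
    · intro H w hw
      have := H (Fin.init w) (fun i => hw _) (w (Fin.last k)) (hw _)
      rwa [← h, Fin.snoc_init_self] at this
    · intro H w hw a ha
      rw [← h]
      refine H _ fun i => ?_
      refine Fin.lastCases ?_ (fun i => ?_) i
      · simpa using ha
      · simpa using hw i

theorem realizeIn_prenexNeg (M : Type) [L.Structure M] (U : Set M) {n : ℕ} (φ : Fml L n)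
    (v : Fin n → M) : φ.prenexNeg.RealizeIn M U v ↔ ¬ φ.RealizeIn M U v := by
  induction φ with
  | all φ ih => simp [prenexNeg, RealizeIn, ih]
  | ex φ ih => simp [prenexNeg, RealizeIn, ih]
  | _ => simp only [prenexNeg, RealizeIn]

theorem FullyBounded.prenexNeg_eq {n : ℕ} {φ : Fml L n} (h : φ.FullyBounded) :
    φ.prenexNeg = φ.neg := by
  cases φ with
  | all φ => exact h.elim
  | ex φ => exact h.elim
  | _ => rfl

end Fml

-- The first level of the arithmetical hierarchy

section Hierarchy

variable {L : FirstOrder.Language.{0, 0}} [L.IsOrdered] {D : (n : ℕ) → Set (Fml L n)}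

theorem isPi_zero_iff {n : ℕ} {φ : Fml L n} : IsPi D 0 n φ ↔ φ ∈ D n :=
  ⟨fun h => by cases h; assumption, .delta⟩

theorem isSigma_zero_iff {n : ℕ} {φ : Fml L n} : IsSigma D 0 n φ ↔ φ ∈ D n :=
  ⟨fun h => by cases h; assumption, .delta⟩

theorem IsPi.one_cases {n : ℕ} {φ : Fml L n} (h : IsPi D 1 n φ) :
    φ ∈ D n ∨ ∃ ψ, φ = .all ψ ∧ IsPi D 1 (n + 1) ψ := by
  cases h with
  | matrix h => exact .inl (isSigma_zero_iff.1 h)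
  | all h => exact .inr ⟨_, rfl, h⟩

theorem isPi_one_of_mem {n : ℕ} {φ : Fml L n} (h : φ ∈ D n) : IsPi D 1 n φ := .matrix (.delta h)

theorem isSigma_one_of_mem {n : ℕ} {φ : Fml L n} (h : φ ∈ D n) : IsSigma D 1 n φ :=
  .matrix (.delta h)

/-- Restricting the range of the unbounded quantifiers preserves the truth of `Π₁` formulas. -/
theorem IsPi.realizeIn_anti (hD : ∀ n, ∀ φ ∈ D n, φ.FullyBounded) {M : Type} [L.Structure M]
    {U V : Set M} (hUV : U ⊆ V) {n : ℕ} {φ : Fml L n} (h : IsPi D 1 n φ) {v : Fin n → M}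
    (hφ : φ.RealizeIn M V v) : φ.RealizeIn M U v := by
  -- `IsPi` is mutually inductive with `IsSigma`, so the induction is on `φ`, with `one_cases`
  -- unpacking the prefix.
  induction φ with
  | all φ ih =>
    obtain h | ⟨ψ, hψ, h⟩ := h.one_cases
    · exact (hD _ _ h).elim
    · cases hψ
      exact fun a ha => ih h (hφ a (hUV ha))
  | _ =>
    obtain h | ⟨ψ, hψ, -⟩ := h.one_cases
    · rw [(hD _ _ h).realizeIn_iff] at hφ ⊢
      exact hφ
    · cases hψ

theorem IsPi.isSigma_prenexNeg (hD : ∀ n, ∀ φ ∈ D n, φ.FullyBounded)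
    (hneg : ∀ n, ∀ φ ∈ D n, φ.neg ∈ D n) {n : ℕ} {φ : Fml L n} (h : IsPi D 1 n φ) :
    IsSigma D 1 n φ.prenexNeg := by
  induction φ with
  | all φ ih =>
    obtain h | ⟨ψ, hψ, h⟩ := h.one_cases
    · exact (hD _ _ h).elim
    · cases hψ
      exact .ex (ih h)
  | _ =>
    obtain h | ⟨ψ, hψ, -⟩ := h.one_cases
    · rw [(hD _ _ h).prenexNeg_eq]
      exact isSigma_one_of_mem (hneg _ _ h)
    · cases hψ

end Hierarchy

-- Recursive enumerability and powers of two

theorem _root_.REPred.or_computablePred {α : Type*} [Primcodable α] {p q : α → Prop}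
    (hp : REPred p) (hq : ComputablePred q) : REPred fun a => p a ∨ q a := by
  obtain ⟨_, hq⟩ := hq
  -- Decide `q` first: halt if it holds, otherwise run the semi-decision procedure for `p`.
  refine (Partrec.cond hq (Computable.const ()).partrec hp).dom_re.of_eq fun a => ?_
  by_cases h : q a <;> simp [h, Part.assert]

theorem twoPow_mono : Monotone twoPow := by
  intro a b hab
  induction a with
  | bot => exact bot_le
  | top => rw [top_le_iff.1 hab]
  | coe a =>
    induction b with
    | bot => simp at hab
    | top => exact le_top
    | coe b =>
      exact ENNReal.ofReal_le_ofReal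
        (Real.rpow_le_rpow_of_exponent_le one_le_two (EReal.coe_le_coe_iff.1 hab))

theorem natCast_lt_twoPow {v J : ℕ} : (v : ENNReal) < twoPow ((J : ℝ) : EReal) ↔ v < 2 ^ J := by
  change (v : ENNReal) < ENNReal.ofReal ((2 : ℝ) ^ (J : ℝ)) ↔ _
  rw [← ENNReal.ofReal_natCast, ENNReal.ofReal_lt_ofReal_iff (by positivity), Real.rpow_natCast]
  exact_mod_cast Iff.rfl

theorem logb_two_lt_of_lt_two_pow {p J : ℕ} (h : p < 2 ^ (J + 1)) :
    Real.logb 2 p < (J : ℝ) + 1 := by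
  obtain rfl | hp := Nat.eq_zero_or_pos p
  -- The convention `Log(0) = 0` covers a proof with Gödel number `0`.
  · simp only [Nat.cast_zero, Real.logb_zero]
    positivity
  · rw [Real.logb_lt_iff_lt_rpow one_lt_two (by exact_mod_cast hp)]
    exact_mod_cast h

-- Goodness, soundness and R-views

namespace GenericConfiguration

variable {ξ : GenericConfiguration}

theorem good_iff_of_mem_delta {N : EReal} {φ : Sent ξ.lang.L} (h : φ ∈ ξ.delta 0) :
    ξ.Good N φ ↔ ξ.IsTrue φ :=
  (ξ.delta_fullyBounded _ _ h).realizeIn_iff _ _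

theorem good_prenexNeg {N : EReal} {φ : Sent ξ.lang.L} :
    ξ.Good N φ.prenexNeg ↔ ¬ ξ.Good N φ :=
  Fml.realizeIn_prenexNeg _ _ _ _

theorem Good.anti {φ : Sent ξ.lang.L} (hφ : IsPi ξ.delta 1 0 φ) {N N' : EReal} (h : N' ≤ N)
    (hN : ξ.Good N φ) : ξ.Good N' φ :=
  hφ.realizeIn_anti ξ.delta_fullyBounded (fun _ hv => lt_of_lt_of_le hv (twoPow_mono h)) hN

theorem IsTrue.good {φ : Sent ξ.lang.L} (hφ : IsPi ξ.delta 1 0 φ) (h : ξ.IsTrue φ) (N : EReal) :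
    ξ.Good N φ :=
  hφ.realizeIn_anti ξ.delta_fullyBounded (Set.subset_univ _) h

theorem Provable.isTrue {α : Set (Sent ξ.lang.L)} (hα : ∀ ψ ∈ α, ξ.IsTrue ψ)
    {φ : Sent ξ.lang.L} (h : ξ.Provable α φ) : ξ.IsTrue φ := by
  obtain ⟨P, hP⟩ := h
  exact ξ.ded.sound P α φ hP ℕ hα

theorem consistent_of_isTrue {α : Set (Sent ξ.lang.L)} (hα : ∀ ψ ∈ α, ξ.IsTrue ψ) :
    ξ.Consistent α :=
  fun ⟨_, h, h'⟩ => h'.isTrue hα (h.isTrue hα)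

theorem IsRView.union_singleton {θ : Set (Sent ξ.lang.L)} (hθ : ξ.IsRView θ)
    {Φ : Sent ξ.lang.L} (hΦ : IsPi ξ.delta 1 0 Φ) : ξ.IsRView (θ ∪ {Φ}) := by
  refine ⟨?_, ?_⟩
  · rintro φ (h | rfl)
    · exact hθ.1 φ h
    · exact hΦ
  · have h1 : ComputablePred fun c : ℕ => c = Φ.code :=
      (Primrec.eq.comp .id (.const _)).computablePred
    refine (hθ.2.or_computablePred h1).of_eq fun c => ⟨?_, ?_⟩
    · rintro (⟨φ, h, hc⟩ | h)
      · exact ⟨φ, .inl h, hc⟩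
      · exact ⟨Φ, .inr rfl, h.symm⟩
    · rintro ⟨φ, h | rfl, hc⟩
      · exact .inl ⟨φ, h, hc⟩
      · exact .inr hc.symm

theorem le_sharp {θ : Set (Sent ξ.lang.L)} {J : ℕ}
    (h : ∀ φ ∈ θ, ξ.Good ((J : ℝ) : EReal) φ) : ((J : ℝ) : EReal) ≤ ξ.sharp θ :=
  le_sSup ⟨J, rfl, h⟩

-- The meaning of the self-consistency sentence

theorem realizeIn_diag (U : Set ℕ) (γ : Fml ξ.lang.L 1) :
    (ξ.diag γ).RealizeIn ℕ U ![] ↔ γ.RealizeIn ℕ U ![ξ.num γ] := by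
  rw [diag, Fml.realizeIn_subst]
  have : (fun _ : Fin 1 => (ξ.lang.numeral (ξ.num γ)).realize (![] : Fin 0 → ℕ)) =
      ![ξ.num γ] := by
    funext i
    simp [ξ.lang.std_numeral]
  rw [this]

/-- The matrix is fully bounded, so cutting the quantifiers at `U` affects only the prefix; the rest
is variable bookkeeping. -/
theorem realizeIn_gammaFml (U : Set ℕ) {m : ℕ} {ν : Fml ξ.lang.L 2} {σ : Fml ξ.lang.L (3 + m)}
    (hν : ν.FullyBounded) (hσ : σ.FullyBounded) (g : ℕ) :
    (ξ.gammaFml ν m σ).RealizeIn ℕ U ![g] ↔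
      ∀ x ∈ U, ∀ y ∈ U, ∀ p ∈ U, ∀ q ∈ U, ∀ u : Fin m → ℕ, (∀ i, u i ∈ U) →
        ∀ w : Fin m → ℕ, (∀ i, w i ∈ U) →
          ¬ (ν.Realize ℕ ![x, y] ∧ σ.Realize ℕ (Fin.append ![g, x, p] u) ∧
            σ.Realize ℕ (Fin.append ![g, y, q] w)) := by
  rw [gammaFml, Fml.realizeIn_alls]
  simp only [Fml.RealizeIn, Fml.realizeIn_subst, hν.realizeIn_iff, hσ.realizeIn_iff]
  have arg_nu (V : Fin (1 + (4 + (m + m))) → ℕ) (a b : Fin (1 + (4 + (m + m)))) :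
      (fun i => ((![FirstOrder.Language.var a, FirstOrder.Language.var b] :
        Fin 2 → ξ.lang.L.Term (Fin (1 + (4 + (m + m))))) i).realize V) = ![V a, V b] := by
    funext i
    fin_cases i <;> rfl
  have arg_sigma (V : Fin (1 + (4 + (m + m))) → ℕ) (a b c : Fin (1 + (4 + (m + m))))
      (f : Fin m → Fin (1 + (4 + (m + m)))) :
      (fun i => ((Fin.append ![FirstOrder.Language.var a, FirstOrder.Language.var b,
        FirstOrder.Language.var c] (fun i => FirstOrder.Language.var (f i)) :
          Fin (3 + m) → ξ.lang.L.Term (Fin (1 + (4 + (m + m))))) i).realize V) =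
        Fin.append ![V a, V b, V c] (fun i => V (f i)) := by
    funext i
    refine Fin.addCases (fun i => ?_) (fun i => ?_) i
    · rw [Fin.append_left, Fin.append_left]
      fin_cases i <;> rfl
    · rw [Fin.append_right, Fin.append_right, FirstOrder.Language.Term.realize_var]
  have at_zero (W : Fin (4 + (m + m)) → ℕ) (h : 0 < 1 + (4 + (m + m))) :
      (Fin.append ![g] W : Fin (1 + (4 + (m + m))) → ℕ) ⟨0, h⟩ = g :=
    Fin.append_left ![g] W 0
  -- Index `0` is taken by `g`, so the quantified values in `W` are shifted by one.
  have at_pos (W : Fin (4 + (m + m)) → ℕ) (i j : ℕ) (hi : i < 1 + (4 + (m + m)))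
      (hj : j < 4 + (m + m)) (h : i = 1 + j) :
      (Fin.append ![g] W : Fin (1 + (4 + (m + m))) → ℕ) ⟨i, hi⟩ = W ⟨j, hj⟩ := by
    subst h
    exact Fin.append_right ![g] W ⟨j, hj⟩
  have matrix_args (W : Fin (4 + (m + m)) → ℕ) := And.intro
    (at_pos W 1 0 (by omega) (by omega) rfl) <| And.intro
    (at_pos W 2 1 (by omega) (by omega) rfl) <| And.intro
    (at_pos W 3 2 (by omega) (by omega) rfl) (at_pos W 4 3 (by omega) (by omega) rfl)
  have arg_u (W : Fin (4 + (m + m)) → ℕ) :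
      (fun i : Fin m => (Fin.append ![g] W : Fin (1 + (4 + (m + m))) → ℕ) ⟨5 + i, by omega⟩) =
        fun i => W (Fin.natAdd 4 (Fin.castAdd m i)) :=
    funext fun i => at_pos W _ (4 + i) _ (by omega) (by omega)
  have arg_w (W : Fin (4 + (m + m)) → ℕ) :
      (fun i : Fin m => (Fin.append ![g] W : Fin (1 + (4 + (m + m))) → ℕ)
        ⟨5 + m + i, by omega⟩) = fun i => W (Fin.natAdd 4 (Fin.natAdd m i)) :=
    funext fun i => at_pos W _ (4 + (m + i)) _ (by omega) (by omega)
  simp only [arg_nu, arg_sigma, at_zero, matrix_args, arg_u, arg_w]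
  constructor
  · intro H x hx y hy p hp q hq u hu w hw
    have h := H (Fin.append ![x, y, p, q] (Fin.append u w)) fun i => by
      refine Fin.addCases (fun i => ?_) (fun i => ?_) i
      · rw [Fin.append_left]
        fin_cases i <;> assumption
      · rw [Fin.append_right]
        refine Fin.addCases (fun i => ?_) (fun i => ?_) i
        · rw [Fin.append_left]
          exact hu i
        · rw [Fin.append_right]
          exact hw i
    simp only [Fin.append_right, Fin.append_left] at h
    exact h
  · intro H W hW
    exact H _ (hW _) _ (hW _) _ (hW _) _ (hW _) _ (fun _ => hW _) _ fun _ => hW _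

/-- A counterexample to `Γ` below a bound: a `Π_k` sentence `φ`, and proofs `p`, `q` of `φ` and of
its formal negation, with the four Gödel numbers in `U`. -/
theorem exists_of_not_realizeIn_isSelfCons {k : ℕ} {β : Set (Sent ξ.lang.L)} {Φ : Sent ξ.lang.L}
    (h : ξ.IsSelfCons k β Φ) {U : Set ℕ} (hU : ¬ Φ.RealizeIn ℕ U ![]) :
    ∃ (φ : Sent ξ.lang.L) (p q : ℕ), IsPi ξ.delta k 0 φ ∧ ξ.num φ ∈ U ∧
      ξ.num φ.prenexNeg ∈ U ∧ p ∈ U ∧ q ∈ U ∧ ξ.PrfNum (β ∪ {Φ}) φ p ∧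
        ξ.PrfNum (β ∪ {Φ}) φ.prenexNeg q := by
  obtain ⟨ν, hν, m, σ, hσ, hNeg, hPrf, rfl, -⟩ := h
  rw [realizeIn_diag, realizeIn_gammaFml U (ξ.delta_fullyBounded _ _ hν)
    (ξ.delta_fullyBounded _ _ hσ)] at hU
  push Not at hU
  obtain ⟨x, hx, y, hy, p, hp, q, hq, u, -, w, -, hxy, hu, hw⟩ := hU
  obtain ⟨φ, hφ, rfl, rfl⟩ := (hNeg x y).1 hxy
  -- Here `γ` is `Γ` itself, so the added axiom `γ(ḡ)` is exactly `Φ`: this is the self-reference.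
  obtain ⟨φ₁, h₁, hp₁⟩ := (hPrf _ _ _).1 ⟨u, hu⟩
  obtain ⟨φ₂, h₂, hq₂⟩ := (hPrf _ _ _).1 ⟨w, hw⟩
  cases ξ.num_injective 0 h₁
  cases ξ.num_injective 0 h₂
  exact ⟨φ, p, q, hφ, hx, hy, hp, hq, hp₁, hq₂⟩

/-- A counterexample consists of finitely many numbers, hence lies below some `2 ^ J`; their sum
serves as `J`. -/
theorem isTrue_of_forall_good_isSelfCons {k : ℕ} {β : Set (Sent ξ.lang.L)} {Φ : Sent ξ.lang.L}
    (h : ξ.IsSelfCons k β Φ) (hgood : ∀ J : ℕ, ξ.Good ((J : ℝ) : EReal) Φ) : ξ.IsTrue Φ := by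
  obtain ⟨ν, hν, m, σ, hσ, -, -, rfl, -⟩ := h
  have key := fun U => realizeIn_gammaFml (ξ := ξ) U (ξ.delta_fullyBounded _ _ hν)
    (ξ.delta_fullyBounded _ _ hσ) (ξ.num (ξ.gammaFml ν m σ))
  refine (realizeIn_diag _ _).2 ((key _).2 ?_)
  intro x _ y _ p _ q _ u _ w _
  have hJ (v : ℕ) (hv : v ≤ x + y + p + q + (∑ i, u i) + ∑ i, w i) :
      v ∈ {v : ℕ | (v : ENNReal) <
        twoPow (((x + y + p + q + (∑ i, u i) + ∑ i, w i : ℕ) : ℝ) : EReal)} :=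
    natCast_lt_twoPow.2 (hv.trans_lt Nat.lt_two_pow_self)
  have hle (f : Fin m → ℕ) (i : Fin m) : f i ≤ ∑ i, f i :=
    Finset.single_le_sum (fun _ _ => Nat.zero_le _) (Finset.mem_univ i)
  exact (key _).1 ((realizeIn_diag _ _).1 (hgood _)) x (hJ _ (by omega)) y (hJ _ (by omega))
    p (hJ _ (by omega)) q (hJ _ (by omega)) u (fun i => hJ _ (by have := hle u i; omega))
    w (fun i => hJ _ (by have := hle w i; omega))

/-- If `G_k(θ)` is inconsistent, then `θ` extended by `SelfCons^k` proves, by proofs within the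
range to which the stability properties apply, some `Π_k` sentence and its formal negation. -/
theorem exists_short_proofs_of_not_consistent {k : ℕ} {θ : Set (Sent ξ.lang.L)}
    (hθ : ξ.IsRView θ) (htrue : ∀ φ ∈ θ, ξ.IsTrue φ) {Φ : Sent ξ.lang.L}
    (hΦ : ξ.IsSelfCons k (θ ∪ ξ.base) Φ) (hcon : ¬ ξ.Consistent (θ ∪ ξ.base ∪ {Φ})) :
    ∃ (θ' : Set (Sent ξ.lang.L)) (J : ℕ) (φ : Sent ξ.lang.L) (p q : ℕ), ξ.IsRView θ' ∧
      ((J : ℝ) : EReal) ≤ ξ.sharp θ' ∧ IsPi ξ.delta k 0 φ ∧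
      Real.logb 2 p < J + 1 ∧ Real.logb 2 q < J + 1 ∧
      ξ.PrfNum (θ' ∪ ξ.base) φ p ∧ ξ.PrfNum (θ' ∪ ξ.base) φ.prenexNeg q := by
  classical
  have hPi : IsPi ξ.delta 1 0 Φ := by
    obtain ⟨ν, -, m, σ, -, -, -, -, h⟩ := hΦ
    exact h
  have hex : ∃ J : ℕ, ¬ ξ.Good ((J : ℝ) : EReal) Φ := by
    by_contra! hgood
    refine hcon (consistent_of_isTrue ?_)
    rintro ψ ((h | h) | rfl)
    · exact htrue ψ h
    · exact ξ.base_true ψ h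
    · exact isTrue_of_forall_good_isSelfCons hΦ hgood
  obtain ⟨φ, p, q, hφ, hx, hy, hp, hq, hpφ, hqφ⟩ :=
    exists_of_not_realizeIn_isSelfCons hΦ (Nat.find_spec hex)
  rw [Set.mem_ofPred_eq, natCast_lt_twoPow] at hx hy hp hq
  have hmin := fun J => Nat.find_min (m := J) hex
  generalize Nat.find hex = N at hx hy hp hq hmin
  obtain _ | J := N
  -- Below `2 ^ 0` the only number is `0`, so `φ` would coincide with its own negation.
  · have hnum : ξ.num φ.prenexNeg = ξ.num φ := by omega
    have h := good_prenexNeg (ξ := ξ) (N := 0) (φ := φ)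
    rw [ξ.num_injective 0 hnum] at h
    exact (iff_not_self h).elim
  -- `Φ` moves from the axiom side into the R-view, which stability allows to contain false
  -- sentences.
  · have hset : θ ∪ {Φ} ∪ ξ.base = θ ∪ ξ.base ∪ {Φ} := Set.union_right_comm _ _ _
    refine ⟨θ ∪ {Φ}, J, φ, p, q, hθ.union_singleton hPi, le_sharp ?_, hφ,
      logb_two_lt_of_lt_two_pow hp, logb_two_lt_of_lt_two_pow hq, hset ▸ hpφ, hset ▸ hqφ⟩
    rintro ψ (h | rfl)
    · exact (htrue ψ h).good (hθ.1 ψ h) _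
    · exact not_not.1 (hmin J J.lt_succ_self)

-- From stability to consistency preservation

theorem coe_le_sharp_add_one {θ : Set (Sent ξ.lang.L)} {J : ℕ} {r : ℝ}
    (hJ : ((J : ℝ) : EReal) ≤ ξ.sharp θ) (hr : r < J + 1) : (r : EReal) ≤ ξ.sharp θ + 1 :=
  calc (r : EReal) ≤ ((J + 1 : ℝ) : EReal) := EReal.coe_le_coe_iff.2 hr.le
    _ = ((J : ℝ) : EReal) + 1 := rfl
    _ ≤ ξ.sharp θ + 1 := by gcongr

theorem EAStable.consistencyPreserving (h : ξ.EAStable) : ξ.ConsistencyPreserving 1 := by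
  intro θ hθ htrue Φ hΦ
  by_contra hcon
  obtain ⟨θ', J, φ, p, q, hθ', hJ, hφ, hp, hq, hpφ, hqφ⟩ :=
    exists_short_proofs_of_not_consistent hθ htrue hΦ hcon
  have hA := h.2 θ' hθ' φ p hφ hpφ (coe_le_sharp_add_one hJ hp)
  have hE := h.1 θ' hθ' φ.prenexNeg q
    (hφ.isSigma_prenexNeg ξ.delta_fullyBounded ξ.delta_neg) hqφ (coe_le_sharp_add_one hJ hq)
  -- It remains to compare levels: `½⌊Log q⌋ - 1 ≤ ½J ≤ ½♯(θ')`.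
  refine good_prenexNeg.1 hE (hA.anti hφ ?_)
  have hfloor : ((⌊Real.logb 2 q⌋ : ℤ) : ℝ) ≤ J := by
    have : ⌊Real.logb 2 q⌋ < (J : ℤ) + 1 := Int.floor_lt.2 (by exact_mod_cast hq)
    exact_mod_cast Int.lt_add_one_iff.1 this
  calc ((1 / 2 * (⌊Real.logb 2 q⌋ : ℝ) - 1 : ℝ) : EReal)
      ≤ ((1 / 2 * (J : ℝ) : ℝ) : EReal) := EReal.coe_le_coe_iff.2 (by linarith)
    _ = ((1 / 2 : ℝ) : EReal) * ((J : ℝ) : EReal) := EReal.coe_mul _ _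
    _ ≤ ((1 / 2 : ℝ) : EReal) * ξ.sharp θ' :=
      mul_le_mul_of_nonneg_left hJ (EReal.coe_nonneg.2 (by norm_num))

theorem AStable.zeroStable (h : ξ.AStable) : ξ.ZeroStable := fun θ hθ φ p hφ hp hlog =>
  (good_iff_of_mem_delta hφ).1 (h θ hθ φ p (isPi_one_of_mem hφ) hp hlog)

theorem EStable.zeroStable (h : ξ.EStable) : ξ.ZeroStable := fun θ hθ φ p hφ hp hlog =>
  (good_iff_of_mem_delta hφ).1 (h θ hθ φ p (isSigma_one_of_mem hφ) hp hlog)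

theorem ZeroStable.consistencyPreserving (h : ξ.ZeroStable) : ξ.ConsistencyPreserving 0 := by
  intro θ hθ htrue Φ hΦ
  by_contra hcon
  obtain ⟨θ', J, φ, p, q, hθ', hJ, hφ, hp, hq, hpφ, hqφ⟩ :=
    exists_short_proofs_of_not_consistent hθ htrue hΦ hcon
  have hδ := isPi_zero_iff.1 hφ
  rw [(ξ.delta_fullyBounded _ _ hδ).prenexNeg_eq] at hqφ
  exact h θ' hθ' _ q (ξ.delta_neg _ _ hδ) hqφ (coe_le_sharp_add_one hJ hq)
    (h θ' hθ' φ p hδ hpφ (coe_le_sharp_add_one hJ hp))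

end GenericConfiguration

end SelfJust

theorem mainTheorem4 (ξ : SelfJust.GenericConfiguration) :
    (ξ.EAStable → ξ.ConsistencyPreserving 1) ∧
      (ξ.AStable ∨ ξ.EStable ∨ ξ.ZeroStable → ξ.ConsistencyPreserving 0) := by
  refine ⟨fun h => h.consistencyPreserving, ?_⟩
  rintro (h | h | h)
  · exact h.zeroStable.consistencyPreserving
  · exact h.zeroStable.consistencyPreserving
  · exact h.consistencyPreserving
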